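/- Let $\mathbb K$ be a field, $\lambda \in \mathbb K$, $\ell \ge 1$, and let $k_1,\dots,k_\ell \ge 1$ and $r_1 > \cdots > r_\ell \ge 1$ be integers. Let $J_\lambda = \bigoplus_{a=1}^{\ell} k_a J_{\lambda,r_a}$ be the Jordan matrix that is the direct sum, over $a=1,\dots,\ell$, of $k_a$ copies of the Jordan block $J_{\lambda,r_a}$ of size $r_a$ with eigenvalue $\lambda$ (with $1$'s on the superdiagonal). Its rows are indexed by $$\Lambda = \{(i_1,i_2,i_3) \in \mathbb N^3 \mid 1\le i_1\le \ell,\ 1\le i_2\le k_{i_1},\ 1\le i_3\le r_{i_1}\},$$ where $(i_1,i_2,i_3)$ stands for the $i_3$-th row of the $i_2$-th block of size $r_{i_1}$. Order $\Lambda$ totally by $\boldsymbol i > \boldsymbol j$ if and only if $i_1<j_1$, or $i_1=j_1$ and $i_2<j_2$, or $i_1=j_1$, $i_2=j_2$ and $i_3<j_3$. Let $R=\mathbb K[x(\boldsymbol i) \mid \boldsymbol i\in\Lambda]$, let $\boldsymbol x$ be the column vector of the variables, and let $I_\lambda\subseteq R$ be the ideal generated by the $2\times 2$ minors of the augmented matrix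 $(J_\lambda \boldsymbol x \mid \boldsymbol x)$. Let $>_{\mathrm{grevlex}}$ be the graded reverse lexicographic order on the monomials of $R$ with $x(\boldsymbol i)>x(\boldsymbol j)$ if and only if $\boldsymbol i>\boldsymbol j$. For $\boldsymbol i=(i_1,i_2,i_3)\in\Lambda$ with $i_3<r_{i_1}$ write $\boldsymbol i^+=(i_1,i_2,i_3+1)$. Let $\Gamma_1$, $\Gamma_2$ and $\Gamma_3$ be the sets of those pairs $(\boldsymbol i,\boldsymbol j)\in\Lambda\times\Lambda$ with $\boldsymbol i>\boldsymbol j$ and $i_3<r_{i_1}$ for which, respectively, * ($\Gamma_1$) $j_3<r_{j_1}$ and $i_3+j_3\ge r_{j_1}+1$; * ($\Gamma_2$) $j_3<r_{j_1}$ and $i_3+j_3\le r_{j_1}$; * ($\Gamma_3$) $j_3=r_{j_1}$. For $(\boldsymbol i,\boldsymbol j)\in\Gamma_2$ write $\boldsymbol i^*=(i_1,i_2,1)$ and $\boldsymbol j^*=(j_1,j_2,i_3+j_3)$. Set $$G_1=\{x(\boldsymbol i^+)x(\boldsymbol j)\mid (\boldsymbol i,\boldsymbol j)\in\Gamma_1\cup\Gamma_3\},\qquad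 G_2=\{x(\boldsymbol i^+)x(\boldsymbol j)-x(\boldsymbol i^*)x(\boldsymbol j^*)\mid (\boldsymbol i,\boldsymbol j)\in\Gamma_2\},$$ and let $G=\{0\}$ if $r_1=1$ and $G=G_1\cup G_2$ otherwise. Then $G$ is a reduced Gröbner basis of $I_\lambda$ with respect to $>_{\mathrm{grevlex}}$. That is: $G$ is a finite subset of $I_\lambda$ whose leading terms generate the initial ideal of $I_\lambda$ (the ideal generated by the leading terms of all elements of $I_\lambda$); and, if $I_\lambda\ne 0$, every $g\in G$ has leading coefficient $1$ and no monomial occurring in $g$ lies in the ideal generated by the leading terms of the elements of $G\setminus\{g\}$. (For the zero ideal, by convention, the reduced Gröbner basis is $\{0\}$.) -/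

import Mathlib

open MvPolynomial

/-! ### The graded reverse lexicographic order -/

/-- The exponent vectors `σ →₀ ℕ`, to be ordered by the graded reverse lexicographic order. -/
def Grevlex (σ : Type*) : Type _ := σ →₀ ℕ

namespace Grevlex

noncomputable instance (σ : Type*) : AddCommMonoid (Grevlex σ) :=
  inferInstanceAs (AddCommMonoid (σ →₀ ℕ))

/-- The identity map from exponent vectors to `Grevlex σ`. -/
noncomputable def equiv (σ : Type*) : (σ →₀ ℕ) ≃+ Grevlex σ := AddEquiv.refl _

/-- The sorting key of an exponent vector: first the total degree; among exponent vectors of the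
same total degree, the reverse of the lexicographic comparison that starts from the smallest
variable. -/
noncomputable def key {σ : Type*} (a : Grevlex σ) : ℕ ×ₗ (Lex (σ →₀ ℕ))ᵒᵈ :=
  toLex (((equiv σ).symm a).degree, OrderDual.toDual (toLex ((equiv σ).symm a)))

theorem key_injective (σ : Type*) : Function.Injective (key (σ := σ)) := by
  intro a b h
  simp only [key, EmbeddingLike.apply_eq_iff_eq, Prod.mk.injEq] at h
  exact h.2

noncomputable instance (σ : Type*) [LinearOrder σ] : LinearOrder (Grevlex σ) :=
  LinearOrder.lift' key (key_injective σ)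

/-- `a < b` iff `a` has smaller total degree, or the total degrees agree and, at the smallest
variable whose exponents differ, `a` has the larger exponent. -/
theorem lt_iff {σ : Type*} [LinearOrder σ] (a b : σ →₀ ℕ) :
    equiv σ a < equiv σ b ↔ a.degree < b.degree ∨
      (a.degree = b.degree ∧ ∃ i, (∀ j < i, a j = b j) ∧ b i < a i) := by
  change key (equiv σ a) < key (equiv σ b) ↔ _
  simp only [key, Prod.Lex.toLex_lt_toLex, AddEquiv.symm_apply_apply, OrderDual.toDual_lt_toDual,
    Finsupp.Lex.lt_iff, ofLex_toLex]
  constructor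
  · rintro (h | ⟨h, i, hi, h'⟩)
    · exact Or.inl h
    · exact Or.inr ⟨h, i, fun j hj => (hi j hj).symm, h'⟩
  · rintro (h | ⟨h, i, hi, h'⟩)
    · exact Or.inl h
    · exact Or.inr ⟨h, i, fun j hj => (hi j hj).symm, h'⟩

theorem add_lt_add_iff {σ : Type*} [LinearOrder σ] (a b c : σ →₀ ℕ) :
    equiv σ (a + c) < equiv σ (b + c) ↔ equiv σ a < equiv σ b := by
  rw [lt_iff, lt_iff]
  simp

instance (σ : Type*) [LinearOrder σ] : IsOrderedAddMonoid (Grevlex σ) where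
  add_le_add_left a b h c := not_lt.1 fun h' => not_lt.2 h <|
    (add_lt_add_iff ((equiv σ).symm b) ((equiv σ).symm a) ((equiv σ).symm c)).1 h'

theorem degree_le {σ : Type*} [LinearOrder σ] {a b : σ →₀ ℕ} (h : equiv σ a ≤ equiv σ b) :
    a.degree ≤ b.degree := by
  by_contra! h'
  exact not_lt.2 h ((lt_iff b a).2 (Or.inl h'))

instance (σ : Type*) [LinearOrder σ] [Finite σ] : WellFoundedLT (Grevlex σ) := by
  refine ⟨WellFounded.wellFounded_iff_has_min.2 fun s ⟨a, ha⟩ => ?_⟩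
  have hfin : {b : Grevlex σ | b ∈ s ∧ b ≤ a}.Finite := by
    have : {b : σ →₀ ℕ | b.degree ≤ ((equiv σ).symm a).degree}.Finite :=
      Finsupp.finite_of_degree_le _
    exact this.subset fun b hb => degree_le (b := (equiv σ).symm a) hb.2
  obtain ⟨b, hb⟩ := hfin.exists_minimal ⟨a, ha, le_rfl⟩
  refine ⟨b, hb.prop.1, fun c hc hcb => ?_⟩
  exact not_lt.2 (hb.le_of_le ⟨hc, hcb.le.trans hb.prop.2⟩ hcb.le) hcb

end Grevlex

/-- The graded reverse lexicographic order on the monomials in variables indexed by `σ`, where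
the variables are ordered as their indices are. -/
noncomputable def grevlex (σ : Type*) [LinearOrder σ] [Finite σ] : MonomialOrder σ where
  syn := Grevlex σ
  toSyn := Grevlex.equiv σ
  toSyn_monotone a b h := by
    refine not_lt.1 fun h' => ?_
    have hle : a.degree ≤ b.degree := by
      rw [← add_tsub_cancel_of_le h, map_add]
      exact Nat.le_add_right _ _
    rcases (Grevlex.lt_iff b a).1 h' with h' | ⟨hd, i, -, hi⟩
    · exact absurd hle (not_le.2 h')
    · have h2 : b.degree = a.degree + (b - a).degree := by
        rw [← map_add, add_tsub_cancel_of_le h]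
      have h3 : b - a = 0 := (Finsupp.degree_eq_zero_iff _).1 (by omega)
      have h4 := congrArg (fun f => f i) h3
      simp only [Finsupp.tsub_apply, Finsupp.coe_zero, Pi.zero_apply] at h4
      omega

/-! ### Gröbner bases -/

/-- `G` is a Gröbner basis of `I`: a finite subset of `I` whose leading terms generate the initial
ideal, that is, the ideal generated by the leading terms of all elements of `I`. -/
def IsGroebnerBasis {σ K : Type*} [Field K] (m : MonomialOrder σ) (G : Set (MvPolynomial σ K))
    (I : Ideal (MvPolynomial σ K)) : Prop :=
  G.Finite ∧ G ⊆ (I : Set (MvPolynomial σ K)) ∧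
    Ideal.span (m.leadingTerm '' G) = Ideal.span (m.leadingTerm '' (I : Set (MvPolynomial σ K)))

/-- `G` is a reduced Gröbner basis of `I`. For `I ≠ 0`, this means: `G` is a Gröbner basis of `I`,
every element of `G` has leading coefficient `1`, and no monomial that occurs in some `g ∈ G` lies
in the ideal generated by the leading terms of the other elements of `G`. By convention, the
reduced Gröbner basis of the zero ideal is `{0}`. -/
def IsReducedGroebnerBasis {σ K : Type*} [Field K] (m : MonomialOrder σ)
    (G : Set (MvPolynomial σ K)) (I : Ideal (MvPolynomial σ K)) : Prop :=
  IsGroebnerBasis m G I ∧ (I = ⊥ → G = {0}) ∧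
    (I ≠ ⊥ → (∀ g ∈ G, m.leadingCoeff g = 1) ∧
      ∀ g ∈ G, ∀ d ∈ g.support,
        monomial d (1 : K) ∉ Ideal.span (m.leadingTerm '' (G \ {g})))

/-! ### The ideal of a square matrix -/

/-- The augmented matrix `(A x | x)`, where `x` is the column vector of the variables. -/
noncomputable def augmentedMatrix {n K : Type*} [Fintype n] [Field K] (A : Matrix n n K) :
    Matrix n (Fin 2) (MvPolynomial n K) :=
  Matrix.of fun i => ![(A.map (C : K →+* MvPolynomial n K)).mulVec X i, X i]

/-- The ideal generated by the `2 × 2` minors of `(A x | x)`. -/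
noncomputable def matrixIdeal {n K : Type*} [Fintype n] [Field K] (A : Matrix n n K) :
    Ideal (MvPolynomial n K) :=
  Ideal.span {p | ∃ i j : n, p = ((augmentedMatrix A).submatrix ![i, j] id).det}

/-! ### Jordan matrices with a single eigenvalue -/

/-- The index set of the rows of a Jordan matrix with `k a` Jordan blocks of size `r a` for each
`a = 1, …, ℓ`: the triple `(a, b, c)` stands for the `c`-th row of the `b`-th block of size
`r a`. All three indices start at `1`. -/
@[ext]
structure JordanIndex (ℓ : ℕ) (k r : ℕ → ℕ) where
  /-- the index of the block size -/
  a : ℕ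
  /-- the copy of the block of that size -/
  b : ℕ
  /-- the row in the block -/
  c : ℕ
  one_le_a : 1 ≤ a
  a_le : a ≤ ℓ
  one_le_b : 1 ≤ b
  b_le : b ≤ k a
  one_le_c : 1 ≤ c
  c_le : c ≤ r a

namespace JordanIndex

variable {ℓ : ℕ} {k r : ℕ → ℕ}

/-- `i > j` iff `i` comes first lexicographically. -/
noncomputable instance : LinearOrder (JordanIndex ℓ k r) :=
  LinearOrder.lift' (fun i => OrderDual.toDual (toLex (i.a, toLex (i.b, i.c)))) (by
    intro i j h
    simp only [EmbeddingLike.apply_eq_iff_eq, Prod.mk.injEq] at h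
    exact JordanIndex.ext h.1 h.2.1 h.2.2)

theorem gt_iff (i j : JordanIndex ℓ k r) :
    i > j ↔ i.a < j.a ∨ (i.a = j.a ∧ i.b < j.b) ∨ (i.a = j.a ∧ i.b = j.b ∧ i.c < j.c) := by
  change OrderDual.toDual (toLex (j.a, toLex (j.b, j.c))) <
    OrderDual.toDual (toLex (i.a, toLex (i.b, i.c))) ↔ _
  rw [OrderDual.toDual_lt_toDual, Prod.Lex.toLex_lt_toLex, Prod.Lex.toLex_lt_toLex]
  simp only
  tauto

instance : Finite (JordanIndex ℓ k r) :=
  Finite.of_injective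
    (β := (a : Fin (ℓ + 1)) × (Fin (k a + 1) × Fin (r a + 1)))
    (fun i => ⟨⟨i.a, Nat.lt_succ_of_le i.a_le⟩,
      ⟨i.b, Nat.lt_succ_of_le i.b_le⟩, ⟨i.c, Nat.lt_succ_of_le i.c_le⟩⟩) (by
    rintro ⟨a, b, c, _, _, _, _, _, _⟩ ⟨a', b', c', _, _, _, _, _, _⟩ h
    simp only [Sigma.mk.injEq, Fin.mk.injEq] at h
    obtain ⟨rfl, h⟩ := h
    simpa using h)

noncomputable instance : Fintype (JordanIndex ℓ k r) := Fintype.ofFinite _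

/-- The index of the `c`-th row of the Jordan block that contains `i`. -/
def atRow (i : JordanIndex ℓ k r) (c : ℕ) (h1 : 1 ≤ c) (h2 : c ≤ r i.a) : JordanIndex ℓ k r where
  a := i.a
  b := i.b
  c := c
  one_le_a := i.one_le_a
  a_le := i.a_le
  one_le_b := i.one_le_b
  b_le := i.b_le
  one_le_c := h1
  c_le := h2

/-- `i⁺`, the index of the next row of the same Jordan block. -/
def succRow (i : JordanIndex ℓ k r) (h : i.c < r i.a) : JordanIndex ℓ k r :=
  i.atRow (i.c + 1) (Nat.le_add_left 1 i.c) h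

/-- `i^*`, the index of the first row of the same Jordan block. -/
def firstRow (i : JordanIndex ℓ k r) : JordanIndex ℓ k r :=
  i.atRow 1 le_rfl (i.one_le_c.trans i.c_le)

end JordanIndex

/-- The direct sum over `a = 1, …, ℓ` of `k a` copies of the Jordan block of size `r a` with
eigenvalue `lam`: within each block, `lam` on the diagonal and `1` on the superdiagonal. -/
noncomputable def jordanMatrix {K : Type*} [Field K] (ℓ : ℕ) (k r : ℕ → ℕ) (lam : K) :
    Matrix (JordanIndex ℓ k r) (JordanIndex ℓ k r) K :=
  Matrix.of fun i j =>
    if i.a = j.a ∧ i.b = j.b then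
      if j.c = i.c then lam else if j.c = i.c + 1 then 1 else 0
    else 0

/-! ### The set `G` -/

section

variable {ℓ : ℕ} {k r : ℕ → ℕ}

/-- The index pairs `i > j`, neither the last row of its block, with `i₃ + j₃ ≥ r_{j₁} + 1`. -/
structure Gamma₁ (i j : JordanIndex ℓ k r) : Prop where
  gt : i > j
  left_lt : i.c < r i.a
  right_lt : j.c < r j.a
  add_ge : r j.a + 1 ≤ i.c + j.c

/-- The index pairs `i > j`, neither the last row of its block, with `i₃ + j₃ ≤ r_{j₁}`. -/
structure Gamma₂ (i j : JordanIndex ℓ k r) : Prop where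
  gt : i > j
  left_lt : i.c < r i.a
  right_lt : j.c < r j.a
  add_le : i.c + j.c ≤ r j.a

/-- The index pairs `i > j` with `j`, but not `i`, the last row of its block. -/
structure Gamma₃ (i j : JordanIndex ℓ k r) : Prop where
  gt : i > j
  left_lt : i.c < r i.a
  right_eq : j.c = r j.a

end

/-- The monomials `x(i⁺) x(j)` with `(i, j) ∈ Γ₁ ∪ Γ₃`. -/
def groebnerG₁ (K : Type*) [Field K] (ℓ : ℕ) (k r : ℕ → ℕ) :
    Set (MvPolynomial (JordanIndex ℓ k r) K) :=
  {p | ∃ (i j : JordanIndex ℓ k r) (h : Gamma₁ i j ∨ Gamma₃ i j),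
    p = X (i.succRow (h.elim Gamma₁.left_lt Gamma₃.left_lt)) * X j}

/-- The binomials `x(i⁺) x(j) - x(i^*) x(j^*)` with `(i, j) ∈ Γ₂`, where `i^* = (i₁, i₂, 1)` and
`j^* = (j₁, j₂, i₃ + j₃)`. -/
def groebnerG₂ (K : Type*) [Field K] (ℓ : ℕ) (k r : ℕ → ℕ) :
    Set (MvPolynomial (JordanIndex ℓ k r) K) :=
  {p | ∃ (i j : JordanIndex ℓ k r) (h : Gamma₂ i j),
    p = X (i.succRow h.left_lt) * X j -
      X i.firstRow * X (j.atRow (i.c + j.c) (i.one_le_c.trans (Nat.le_add_right _ _)) h.add_le)}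

/-- The set `G`: `{0}` if all blocks have size `1`, and `G₁ ∪ G₂` otherwise. -/
def groebnerG (K : Type*) [Field K] (ℓ : ℕ) (k r : ℕ → ℕ) :
    Set (MvPolynomial (JordanIndex ℓ k r) K) :=
  if r 1 = 1 then {0} else groebnerG₁ K ℓ k r ∪ groebnerG₂ K ℓ k r

/-! Modulo `I_λ` one has `x(i⁺) x(j) = x(i) x(j⁺)`, where `x(i⁺)` is read as `0` if `i` is the last
row of its block. Shifting rows in this way from one factor to the other puts `G` into `I_λ`.

Conversely, `x(i) ↦ y(i₁, i₂) t ^ (i₃ - 1)` maps `I_λ` into the ideal generated by the monomials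
`y(a, b) t ^ r_a`. Call a monomial standard if no leading monomial of `G` divides it. In a standard
monomial only the smallest variable can lie outside the first row of its block, and its block is at
most as large as the others that occur, so the image is not in that ideal; moreover, a standard
monomial is the smallest of all monomials with the same image. If the leading monomial of a nonzero
`f ∈ I_λ` were standard, its image would therefore have a nonzero coefficient in the image of `f`,
which is impossible. -/

section MonomialOrder

variable {σ K : Type*} [Field K] {m : MonomialOrder σ}

theorem monomial_mem_span_leadingTerm_iff {G : Set (MvPolynomial σ K)} {d : σ →₀ ℕ} :
    monomial d (1 : K) ∈ Ideal.span (m.leadingTerm '' G) ↔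
      ∃ g ∈ G, g ≠ 0 ∧ m.degree g ≤ d := by
  classical
  rw [m.span_leadingTerm_eq_span_monomial',
    ← Set.image_image (fun s => monomial s (1 : K)) m.degree, mem_ideal_span_monomial_image]
  simp [support_monomial, and_assoc]

theorem IsGroebnerBasis.of_exists_degree_le {G : Set (MvPolynomial σ K)}
    {I : Ideal (MvPolynomial σ K)} (hfin : G.Finite) (hGI : G ⊆ I)
    (hdeg : ∀ f ∈ I, f ≠ 0 → ∃ g ∈ G, g ≠ 0 ∧ m.degree g ≤ m.degree f) :
    IsGroebnerBasis m G I := by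
  refine ⟨hfin, hGI, (Ideal.span_mono (Set.image_mono hGI)).antisymm (Ideal.span_le.2 ?_)⟩
  rintro _ ⟨f, hf, rfl⟩
  obtain rfl | hf0 := eq_or_ne f 0
  · simp
  · rw [MonomialOrder.leadingTerm, ← mul_one (m.leadingCoeff f), ← C_mul_monomial]
    exact Ideal.mul_mem_left _ _ (monomial_mem_span_leadingTerm_iff.2 (hdeg f hf hf0))

theorem isReducedGroebnerBasis_bot : IsReducedGroebnerBasis m {(0 : MvPolynomial σ K)} ⊥ :=
  ⟨⟨Set.finite_singleton 0, by simp, by simp⟩, fun _ => rfl, fun h => absurd rfl h⟩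

end MonomialOrder

section QuadraticMonomial

variable {σ R : Type*} [CommSemiring R] [Nontrivial R]

theorem support_X_mul_X (i j : σ) :
    (X i * X j : MvPolynomial σ R).support = {Finsupp.single i 1 + Finsupp.single j 1} := by
  classical
  rw [X, X, monomial_mul, one_mul, support_monomial, if_neg one_ne_zero]

theorem degree_X_mul_X {m : MonomialOrder σ} (i j : σ) :
    m.degree (X i * X j : MvPolynomial σ R) = Finsupp.single i 1 + Finsupp.single j 1 := by
  classical
  rw [X, X, monomial_mul, one_mul, m.degree_monomial, if_neg one_ne_zero]

end QuadraticMonomial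

section MonomialHom

variable {σ τ R : Type*} [CommSemiring R]

variable (R) in
/-- The homomorphism of polynomial rings that sends each variable `x(i)` to the monomial with
exponent vector `w i`. It is used to compare monomials through the monomials they are sent to. -/
noncomputable def monomialHom (w : σ → τ →₀ ℕ) :
    MvPolynomial σ R →ₐ[R] MvPolynomial τ R :=
  aeval fun i => monomial (w i) 1

theorem monomialHom_monomial (w : σ → τ →₀ ℕ) (d : σ →₀ ℕ) (c : R) :
    monomialHom R w (monomial d c) = monomial (Finsupp.weight w d) c := by
  simp only [monomialHom, aeval_monomial, Finsupp.weight_apply, monomial_finsupp_sum_index,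
    monomial_pow, one_pow, algebraMap_eq]

theorem coeff_weight_monomialHom {w : σ → τ →₀ ℕ} {f : MvPolynomial σ R} {d : σ →₀ ℕ}
    (hd : ∀ e ∈ f.support, Finsupp.weight w e = Finsupp.weight w d → e = d) :
    coeff (Finsupp.weight w d) (monomialHom R w f) = coeff d f := by
  classical
  conv_lhs => rw [f.as_sum]
  simp only [map_sum, monomialHom_monomial, coeff_sum, coeff_monomial]
  rw [Finset.sum_eq_single d (fun e he hne => if_neg fun h => hne (hd e he h)) (by simp),
    if_pos rfl]

end MonomialHom

section Exponents

variable {σ : Type*} [LinearOrder σ]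

theorem eq_and_eq_of_single_add_single_le {i j i' j' : σ} (hji : j ≤ i) (hji' : j' ≤ i')
    (h : Finsupp.single i 1 + Finsupp.single j 1 ≤
      (Finsupp.single i' 1 + Finsupp.single j' 1 : σ →₀ ℕ)) : i = i' ∧ j = j' := by
  obtain ⟨e, he⟩ := exists_add_of_le h
  have he0 : e = 0 := by
    have hdeg := congrArg Finsupp.degree he
    simp only [map_add, Finsupp.degree_single] at hdeg
    exact (Finsupp.degree_eq_zero_iff e).1 (by omega)
  rw [he0, add_zero, Finsupp.single_add_single_eq_single_add_single one_ne_zero one_ne_zero] at he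
  grind

theorem grevlex_lt_of_forall_lt [Finite σ] {d e : σ →₀ ℕ} (hdeg : d.degree ≤ e.degree) {s : σ}
    (hs : d s ≠ 0) (he : ∀ u, e u ≠ 0 → s < u) :
    (grevlex σ).toSyn d < (grevlex σ).toSyn e := by
  refine (Grevlex.lt_iff d e).2 (hdeg.lt_or_eq.imp_right fun hdeg => ⟨hdeg, ?_⟩)
  have hsupp : s ∈ d.support := Finsupp.mem_support_iff.2 hs
  set t := d.support.min' ⟨s, hsupp⟩
  have hts : t ≤ s := Finset.min'_le _ _ hsupp
  have he0 : ∀ u ≤ t, e u = 0 := fun u hu => by_contra fun h => (he u h).not_ge (hu.trans hts)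
  refine ⟨t, fun u hu => ?_, ?_⟩
  · rw [he0 u hu.le]
    exact Finsupp.notMem_support_iff.1 fun h => (Finset.min'_le _ _ h).not_gt hu
  · rw [he0 t le_rfl]
    exact Nat.pos_of_ne_zero (Finsupp.mem_support_iff.1 (Finset.min'_mem _ _))

end Exponents

namespace JordanIndex

variable {ℓ : ℕ} {k r : ℕ → ℕ}

theorem lt_iff {i j : JordanIndex ℓ k r} :
    i < j ↔ j.a < i.a ∨ (j.a = i.a ∧ j.b < i.b) ∨ (j.a = i.a ∧ j.b = i.b ∧ j.c < i.c) :=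
  gt_iff j i

theorem a_le_of_le {i j : JordanIndex ℓ k r} (h : i ≤ j) : j.a ≤ i.a :=
  not_lt.1 fun ha => h.not_gt (lt_iff.2 (Or.inl ha))

theorem c_lt_of_lt_of_le {s v u : JordanIndex ℓ k r} (hsv : s < v) (hvu : v ≤ u)
    (ha : u.a = s.a) (hb : u.b = s.b) : v.c < s.c := by
  rw [lt_iff] at hsv
  rw [← not_lt, lt_iff] at hvu
  omega

theorem atRow_lt {i : JordanIndex ℓ k r} {c : ℕ} (h1 : 1 ≤ c) (h2 : c ≤ r i.a) (h : i.c < c) :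
    i.atRow c h1 h2 < i :=
  lt_iff.2 (Or.inr (Or.inr ⟨rfl, rfl, h⟩))

theorem le_firstRow (i : JordanIndex ℓ k r) : i ≤ i.firstRow := by
  have h := i.one_le_c
  rw [← not_lt, lt_iff]
  simp only [firstRow, atRow]
  omega

theorem le_succRow_iff {i j : JordanIndex ℓ k r} (h : i.c < r i.a) :
    j ≤ i.succRow h ↔ j < i := by
  rw [← not_lt, lt_iff, lt_iff]
  simp only [succRow, atRow]
  omega

theorem c_succRow_add_sub_one (i : JordanIndex ℓ k r) (h : i.c < r i.a) (n : ℕ) :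
    (i.succRow h).c + n - 1 = i.c + n := by
  simp only [succRow, atRow]
  omega

theorem c_succRow_ne_one (i : JordanIndex ℓ k r) (h : i.c < r i.a) : (i.succRow h).c ≠ 1 :=
  (Nat.succ_lt_succ i.one_le_c).ne'

theorem exists_succRow_eq {i : JordanIndex ℓ k r} (hi : i.c ≠ 1) :
    ∃ (p : JordanIndex ℓ k r) (h : p.c < r p.a), p.succRow h = i := by
  have h1 := i.one_le_c
  have h2 := i.c_le
  exact ⟨i.atRow (i.c - 1) (by omega) (by omega), show i.c - 1 < r i.a by omega,
    JordanIndex.ext rfl rfl (show i.c - 1 + 1 = i.c by omega)⟩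

/-- The variable in row `c` of the Jordan block that contains `i`, or `0` if the block has no such
row. The value `0` makes the minors of `(J x | x)` and the elements of `G` uniform in the rows. -/
noncomputable def rowVar (K : Type*) [CommSemiring K] (i : JordanIndex ℓ k r) (c : ℕ) :
    MvPolynomial (JordanIndex ℓ k r) K :=
  if h : 1 ≤ c ∧ c ≤ r i.a then X (i.atRow c h.1 h.2) else 0

variable {K : Type*} [CommSemiring K]

theorem rowVar_of_le (i : JordanIndex ℓ k r) {c : ℕ} (h1 : 1 ≤ c) (h2 : c ≤ r i.a) :
    rowVar K i c = X (i.atRow c h1 h2) :=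
  dif_pos ⟨h1, h2⟩

theorem rowVar_of_lt (i : JordanIndex ℓ k r) {c : ℕ} (h : r i.a < c) : rowVar K i c = 0 :=
  dif_neg fun hc => hc.2.not_gt h

theorem rowVar_atRow (i : JordanIndex ℓ k r) {c : ℕ} (h1 : 1 ≤ c) (h2 : c ≤ r i.a) (d : ℕ) :
    rowVar K (i.atRow c h1 h2) d = rowVar K i d :=
  rfl

theorem rowVar_self (i : JordanIndex ℓ k r) : rowVar K i i.c = X i :=
  rowVar_of_le i i.one_le_c i.c_le

theorem rowVar_one (i : JordanIndex ℓ k r) : rowVar K i 1 = X i.firstRow :=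
  rowVar_of_le i _ _

end JordanIndex

open JordanIndex

section MatrixIdeal

variable {K : Type*} [Field K] {ℓ : ℕ} {k r : ℕ → ℕ}

theorem sum_ite_succ_row_eq_rowVar {K : Type*} [CommSemiring K] (i : JordanIndex ℓ k r) :
    ∑ j : JordanIndex ℓ k r, (if j.a = i.a ∧ j.b = i.b ∧ j.c = i.c + 1 then X j else 0) =
      rowVar K i (i.c + 1) := by
  by_cases h : i.c < r i.a
  · have hiff : ∀ j : JordanIndex ℓ k r,
        j.a = i.a ∧ j.b = i.b ∧ j.c = i.c + 1 ↔ j = i.succRow h := fun j =>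
      (JordanIndex.ext_iff (x := j) (y := i.succRow h)).symm
    simp only [hiff, Finset.sum_ite_eq', Finset.mem_univ, if_true]
    exact (rowVar_of_le i _ _).symm
  · rw [rowVar_of_lt i (by omega)]
    refine Finset.sum_eq_zero fun j _ => if_neg ?_
    rintro ⟨ha, -, hc⟩
    have hj := j.c_le
    rw [ha] at hj
    omega

theorem jordanMatrix_mulVec_X (lam : K) (i : JordanIndex ℓ k r) :
    ((jordanMatrix ℓ k r lam).map (C : K →+* MvPolynomial (JordanIndex ℓ k r) K)).mulVec X i =
      C lam * X i + rowVar K i (i.c + 1) := by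
  have hrow : ∀ j : JordanIndex ℓ k r, (C (jordanMatrix ℓ k r lam i j) * X j :
      MvPolynomial (JordanIndex ℓ k r) K) = (if j = i then C lam * X j else 0) +
        if j.a = i.a ∧ j.b = i.b ∧ j.c = i.c + 1 then X j else 0 := by
    intro j
    simp only [jordanMatrix, Matrix.of_apply, JordanIndex.ext_iff]
    split_ifs <;> first | omega | simp
  simp only [Matrix.mulVec, dotProduct, Matrix.map_apply, hrow, Finset.sum_add_distrib,
    Finset.sum_ite_eq', Finset.mem_univ, if_true, sum_ite_succ_row_eq_rowVar]

theorem det_submatrix_augmentedMatrix_jordanMatrix (lam : K) (i j : JordanIndex ℓ k r) :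
    ((augmentedMatrix (jordanMatrix ℓ k r lam)).submatrix ![i, j] id).det =
      rowVar K i (i.c + 1) * X j - X i * rowVar K j (j.c + 1) := by
  simp only [augmentedMatrix, Matrix.det_fin_two, Matrix.submatrix_apply, Matrix.of_apply,
    jordanMatrix_mulVec_X, id, Matrix.cons_val_zero, Matrix.cons_val_one]
  ring

theorem rowVar_succ_mul_sub_mul_succ_mem (lam : K) (i j : JordanIndex ℓ k r) {p q : ℕ}
    (hp : 1 ≤ p) (hq : 1 ≤ q) :
    rowVar K i (p + 1) * rowVar K j q - rowVar K i p * rowVar K j (q + 1) ∈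
      matrixIdeal (jordanMatrix ℓ k r lam) := by
  obtain hp' | hp' := lt_or_ge (r i.a) p
  · simp [rowVar_of_lt i hp', rowVar_of_lt i (hp'.trans p.lt_succ_self)]
  obtain hq' | hq' := lt_or_ge (r j.a) q
  · simp [rowVar_of_lt j hq', rowVar_of_lt j (hq'.trans q.lt_succ_self)]
  have hdet := det_submatrix_augmentedMatrix_jordanMatrix lam (i.atRow p hp hp') (j.atRow q hq hq')
  rw [rowVar_atRow, rowVar_atRow, ← rowVar_of_le i hp hp', ← rowVar_of_le j hq hq'] at hdet
  exact Ideal.subset_span ⟨_, _, hdet.symm⟩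

theorem rowVar_mul_sub_first_mul_mem (lam : K) (i j : JordanIndex ℓ k r) (p : ℕ) {q : ℕ}
    (hq : 1 ≤ q) :
    rowVar K i (p + 1) * rowVar K j q - rowVar K i 1 * rowVar K j (p + q) ∈
      matrixIdeal (jordanMatrix ℓ k r lam) := by
  induction p generalizing q with
  | zero => simp
  | succ p ih =>
    have h := add_mem (rowVar_succ_mul_sub_mul_succ_mem lam i j p.succ_pos hq) (ih q.succ_pos)
    rwa [sub_add_sub_cancel, show p + (q + 1) = p + 1 + q by ring] at h

theorem matrixIdeal_jordanMatrix_eq_bot (lam : K) (hr : ∀ i : JordanIndex ℓ k r, r i.a ≤ 1) :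
    matrixIdeal (jordanMatrix ℓ k r lam) = ⊥ := by
  refine Ideal.span_eq_bot.2 ?_
  rintro _ ⟨i, j, rfl⟩
  have hlt : ∀ i : JordanIndex ℓ k r, r i.a < i.c + 1 := fun i =>
    Nat.lt_succ_of_le ((hr i).trans i.one_le_c)
  rw [det_submatrix_augmentedMatrix_jordanMatrix, rowVar_of_lt i (hlt i), rowVar_of_lt j (hlt j),
    zero_mul, mul_zero, sub_zero]

end MatrixIdeal

section GroebnerElement

variable {K : Type*} [Field K] {ℓ : ℕ} {k r : ℕ → ℕ} {i j : JordanIndex ℓ k r}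

variable (K) in
/-- The element of `G` with leading monomial `x(i) x(j)`, where `j ≤ i` and `i` is not the first
row of its block. In the notation of `groebnerG₁` and `groebnerG₂` it is the element attached to
the pair `(p, j)` with `p⁺ = i`. -/
noncomputable def groebnerElement (i j : JordanIndex ℓ k r) :
    MvPolynomial (JordanIndex ℓ k r) K :=
  X i * X j - rowVar K i 1 * rowVar K j (i.c + j.c - 1)

theorem groebnerElement_succRow_of_lt (h : i.c < r i.a) (hlt : r j.a < i.c + j.c) :
    groebnerElement K (i.succRow h) j = X (i.succRow h) * X j := by
  rw [groebnerElement, c_succRow_add_sub_one, rowVar_of_lt j hlt, mul_zero, sub_zero]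

theorem groebnerElement_succRow_of_le (h : i.c < r i.a) (hle : i.c + j.c ≤ r j.a) :
    groebnerElement K (i.succRow h) j = X (i.succRow h) * X j -
      X i.firstRow * X (j.atRow (i.c + j.c) (i.one_le_c.trans (Nat.le_add_right _ _)) hle) := by
  rw [groebnerElement, c_succRow_add_sub_one, rowVar_one, rowVar_of_le j _ hle]
  rfl

theorem groebnerElement_eq_X_mul_X_or_eq_sub (hi : i.c ≠ 1) :
    groebnerElement K i j = X i * X j ∨
      ∃ v < j, groebnerElement K i j = X i * X j - X i.firstRow * X v := by
  obtain ⟨p, hp, rfl⟩ := exists_succRow_eq hi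
  obtain hlt | hle := lt_or_ge (r j.a) (p.c + j.c)
  · exact Or.inl (groebnerElement_succRow_of_lt hp hlt)
  · exact Or.inr ⟨_, atRow_lt _ hle (Nat.lt_add_of_pos_left p.one_le_c),
      groebnerElement_succRow_of_le hp hle⟩

theorem mem_groebnerG₁_union_groebnerG₂ {f : MvPolynomial (JordanIndex ℓ k r) K} :
    f ∈ groebnerG₁ K ℓ k r ∪ groebnerG₂ K ℓ k r ↔
      ∃ i j : JordanIndex ℓ k r, i.c ≠ 1 ∧ j ≤ i ∧ groebnerElement K i j = f := by
  constructor
  · rintro (⟨p, j, h, rfl⟩ | ⟨p, j, h, rfl⟩)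
    · have hp := h.elim Gamma₁.left_lt Gamma₃.left_lt
      have hlt : r j.a < p.c + j.c :=
        h.elim Gamma₁.add_ge fun h => h.right_eq ▸ Nat.lt_add_of_pos_left p.one_le_c
      exact ⟨p.succRow hp, j, c_succRow_ne_one p hp,
        (le_succRow_iff hp).2 (h.elim Gamma₁.gt Gamma₃.gt), groebnerElement_succRow_of_lt hp hlt⟩
    · exact ⟨p.succRow h.left_lt, j, c_succRow_ne_one p h.left_lt,
        (le_succRow_iff h.left_lt).2 h.gt, groebnerElement_succRow_of_le h.left_lt h.add_le⟩
  · rintro ⟨i, j, hi, hji, rfl⟩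
    obtain ⟨p, hp, rfl⟩ := exists_succRow_eq hi
    have hjp := (le_succRow_iff hp).1 hji
    obtain hle | hlt := le_or_gt (p.c + j.c) (r j.a)
    · have hj := (Nat.lt_add_of_pos_left p.one_le_c).trans_le hle
      exact Or.inr ⟨p, j, ⟨hjp, hp, hj, hle⟩, groebnerElement_succRow_of_le hp hle⟩
    · refine Or.inl ⟨p, j, ?_, groebnerElement_succRow_of_lt hp hlt⟩
      exact j.c_le.lt_or_eq.imp (fun hj => ⟨hjp, hp, hj, hlt⟩) fun hj => ⟨hjp, hp, hj⟩

theorem groebnerElement_mem_matrixIdeal (lam : K) (i j : JordanIndex ℓ k r) :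
    groebnerElement K i j ∈ matrixIdeal (jordanMatrix ℓ k r lam) := by
  have hi := i.one_le_c
  have h := rowVar_mul_sub_first_mul_mem lam i j (i.c - 1) j.one_le_c
  rwa [Nat.sub_add_cancel hi, rowVar_self, rowVar_self, ← Nat.sub_add_comm hi] at h

theorem degree_X_firstRow_mul_X_lt {v : JordanIndex ℓ k r} (hji : j ≤ i) (hv : v < j) :
    (grevlex _).toSyn ((grevlex _).degree (X i.firstRow * X v : MvPolynomial _ K)) <
      (grevlex _).toSyn ((grevlex _).degree (X i * X j : MvPolynomial _ K)) := by
  simp only [degree_X_mul_X]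
  refine grevlex_lt_of_forall_lt (s := v) (by simp) (by simp) fun u hu => ?_
  have hu : i = u ∨ j = u := by simpa [Finsupp.single_apply, or_iff_not_imp_left] using hu
  obtain rfl | rfl := hu
  · exact hv.trans_le hji
  · exact hv

theorem degree_groebnerElement (hi : i.c ≠ 1) (hji : j ≤ i) :
    (grevlex _).degree (groebnerElement K i j) = Finsupp.single i 1 + Finsupp.single j 1 := by
  obtain h | ⟨v, hv, h⟩ := groebnerElement_eq_X_mul_X_or_eq_sub (K := K) (j := j) hi
  · rw [h, degree_X_mul_X]
  · rw [h, MonomialOrder.degree_sub_of_lt (degree_X_firstRow_mul_X_lt hji hv), degree_X_mul_X]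

theorem monic_groebnerElement (hi : i.c ≠ 1) (hji : j ≤ i) :
    (grevlex _).Monic (groebnerElement K i j) := by
  have hmonic : (grevlex _).Monic (X i * X j : MvPolynomial _ K) :=
    MonomialOrder.monic_X.mul MonomialOrder.monic_X
  obtain h | ⟨v, hv, h⟩ := groebnerElement_eq_X_mul_X_or_eq_sub (K := K) (j := j) hi
  · rwa [h]
  · rw [h]
    exact (MonomialOrder.leadingCoeff_sub_of_lt (degree_X_firstRow_mul_X_lt hji hv)).trans hmonic

/-- The exponent vectors of the standard monomials: those divisible by no leading monomial
`x(i) x(j)` of an element of `G`. -/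
def IsStandardExponent (d : JordanIndex ℓ k r →₀ ℕ) : Prop :=
  ∀ ⦃i j : JordanIndex ℓ k r⦄, i.c ≠ 1 → j ≤ i → ¬ Finsupp.single i 1 + Finsupp.single j 1 ≤ d

theorem isStandardExponent_single_firstRow_add_single {v : JordanIndex ℓ k r}
    (hv : v ≤ i.firstRow) :
    IsStandardExponent (Finsupp.single i.firstRow 1 + Finsupp.single v 1) := by
  intro i' j' hi' hji' hle
  obtain ⟨rfl, -⟩ := eq_and_eq_of_single_add_single_le hji' hv hle
  exact hi' rfl

theorem eq_or_isStandardExponent_of_mem_support (hi : i.c ≠ 1) (hji : j ≤ i)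
    {d : JordanIndex ℓ k r →₀ ℕ} (hd : d ∈ (groebnerElement K i j).support) :
    d = Finsupp.single i 1 + Finsupp.single j 1 ∨ IsStandardExponent d := by
  obtain h | ⟨v, hv, h⟩ := groebnerElement_eq_X_mul_X_or_eq_sub (K := K) (j := j) hi
  · rw [h, support_X_mul_X, Finset.mem_singleton] at hd
    exact Or.inl hd
  · rw [h] at hd
    have hd := support_sub _ _ _ hd
    rw [support_X_mul_X, support_X_mul_X, Finset.mem_union, Finset.mem_singleton,
      Finset.mem_singleton] at hd
    have hvi : v ≤ i.firstRow := hv.le.trans (hji.trans i.le_firstRow)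
    refine hd.imp_right ?_
    rintro rfl
    exact isStandardExponent_single_firstRow_add_single hvi

theorem groebnerElement_eq_of_degree_le {i' j' : JordanIndex ℓ k r} (hi : i.c ≠ 1) (hji : j ≤ i)
    (hi' : i'.c ≠ 1) (hji' : j' ≤ i') {d : JordanIndex ℓ k r →₀ ℕ}
    (hd : d ∈ (groebnerElement K i j).support)
    (hle : (grevlex _).degree (groebnerElement K i' j') ≤ d) :
    groebnerElement K i' j' = groebnerElement K i j := by
  rw [degree_groebnerElement hi' hji'] at hle
  obtain rfl | hstd := eq_or_isStandardExponent_of_mem_support hi hji hd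
  · obtain ⟨rfl, rfl⟩ := eq_and_eq_of_single_add_single_le hji' hji hle
    rfl
  · exact absurd hle (hstd hi' hji')

end GroebnerElement

section BlockWeight

variable {ℓ : ℕ} {k r : ℕ → ℕ} {d m : JordanIndex ℓ k r →₀ ℕ}

/-- The exponent vector of the monomial `y(i₁, i₂) t ^ (i₃ - 1)`, with one variable `y` for each
Jordan block and one further variable `t`, indexed by `none`. Both terms of each element of `G₂` are
sent to the same monomial if `x(i)` is sent to `y(i₁, i₂) t ^ (i₃ - 1)`. -/
noncomputable def blockWeight (i : JordanIndex ℓ k r) : Option (ℕ × ℕ) →₀ ℕ :=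
  Finsupp.single (some (i.a, i.b)) 1 + Finsupp.single none (i.c - 1)

theorem weight_blockWeight_none (d : JordanIndex ℓ k r →₀ ℕ) :
    Finsupp.weight blockWeight d none = ∑ i, d i * (i.c - 1) := by
  simp [Finsupp.weight_eq_sum, Finsupp.finsetSum_apply, blockWeight]

theorem weight_blockWeight_some (d : JordanIndex ℓ k r →₀ ℕ) (x : ℕ × ℕ) :
    Finsupp.weight blockWeight d (some x) = ∑ i, if (i.a, i.b) = x then d i else 0 := by
  simp [Finsupp.weight_eq_sum, Finsupp.finsetSum_apply, blockWeight, Finsupp.single_apply]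

theorem weight_blockWeight_none_eq_zero_iff :
    Finsupp.weight blockWeight d none = 0 ↔ ∀ i, d i ≠ 0 → i.c = 1 := by
  rw [weight_blockWeight_none, Finset.sum_eq_zero_iff]
  refine ⟨fun h i hi => ?_, fun h i _ => ?_⟩
  · have h1 := i.one_le_c
    have hc := (mul_eq_zero.1 (h i (Finset.mem_univ i))).resolve_left hi
    omega
  · by_cases hi : d i = 0
    · rw [hi, zero_mul]
    · rw [h i hi, Nat.sub_self, mul_zero]

theorem weight_blockWeight_some_ne_zero_iff {x : ℕ × ℕ} :
    Finsupp.weight blockWeight d (some x) ≠ 0 ↔ ∃ i, d i ≠ 0 ∧ (i.a, i.b) = x := by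
  rw [weight_blockWeight_some, Ne, Finset.sum_eq_zero_iff]
  simp [and_comm]

theorem weight_blockWeight_some_eq (h : Finsupp.weight blockWeight d none = 0)
    (i : JordanIndex ℓ k r) :
    Finsupp.weight blockWeight d (some (i.a, i.b)) = d i.firstRow := by
  rw [weight_blockWeight_none_eq_zero_iff] at h
  rw [weight_blockWeight_some, Finset.sum_eq_single i.firstRow _ (by simp)]
  · exact if_pos rfl
  · intro j _ hj
    refine ite_eq_right_iff.2 fun hij => by_contra fun hd => hj ?_
    exact JordanIndex.ext (Prod.mk.inj hij).1 (Prod.mk.inj hij).2 (h j hd)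

theorem eq_of_weight_blockWeight_eq (hd : Finsupp.weight blockWeight d none = 0)
    (h : Finsupp.weight blockWeight m = Finsupp.weight blockWeight d) : m = d := by
  have hm : Finsupp.weight blockWeight m none = 0 := by rw [h, hd]
  ext i
  by_cases hi : i.c = 1
  · have hfirst : i.firstRow = i := JordanIndex.ext rfl rfl hi.symm
    rw [← hfirst, ← weight_blockWeight_some_eq hm, ← weight_blockWeight_some_eq hd, h]
  · rw [not_imp_comm.1 (weight_blockWeight_none_eq_zero_iff.1 hm i) hi,
      not_imp_comm.1 (weight_blockWeight_none_eq_zero_iff.1 hd i) hi]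

theorem degree_weight_blockWeight (d : JordanIndex ℓ k r →₀ ℕ) :
    (Finsupp.weight blockWeight d).degree = d.degree + Finsupp.weight blockWeight d none := by
  have hblock : ∀ i : JordanIndex ℓ k r, (blockWeight i).degree = 1 + (i.c - 1) := fun i => by
    rw [blockWeight, map_add, Finsupp.degree_single, Finsupp.degree_single]
  rw [weight_blockWeight_none]
  simp only [Finsupp.weight_eq_sum, map_sum, map_nsmul, hblock,
    smul_eq_mul, mul_add, mul_one, Finset.sum_add_distrib, Finsupp.degree_eq_sum]

end BlockWeight

section StandardExponent

variable {ℓ : ℕ} {k r : ℕ → ℕ} {d m : JordanIndex ℓ k r →₀ ℕ} {v s : JordanIndex ℓ k r}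

theorem IsStandardExponent.exists_eq_single_add (hd : IsStandardExponent d) (h0 : d ≠ 0) :
    ∃ v e, d = Finsupp.single v 1 + e ∧ (∀ u, d u ≠ 0 → v ≤ u) ∧
      Finsupp.weight blockWeight e none = 0 := by
  obtain ⟨v, hv, hmin⟩ := d.support.exists_minimal (Finsupp.support_nonempty_iff.2 h0)
  have hle : ∀ u, d u ≠ 0 → v ≤ u := fun u hu =>
    not_lt.1 fun huv => (hmin (Finsupp.mem_support_iff.2 hu) huv.le).not_gt huv
  obtain ⟨e, rfl⟩ := exists_add_of_le
    (Finsupp.single_le_iff.2 (Nat.one_le_iff_ne_zero.2 (Finsupp.mem_support_iff.1 hv)))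
  refine ⟨v, e, rfl, hle, weight_blockWeight_none_eq_zero_iff.2 fun u hu => ?_⟩
  by_contra hc
  refine hd hc (hle u (by simp [hu])) ?_
  rw [add_comm]
  exact add_le_add le_rfl (Finsupp.single_le_iff.2 (Nat.one_le_iff_ne_zero.2 hu))

theorem weight_blockWeight_single_add_none {e : JordanIndex ℓ k r →₀ ℕ}
    (he : Finsupp.weight blockWeight e none = 0) :
    Finsupp.weight blockWeight (Finsupp.single v 1 + e) none = v.c - 1 := by
  simp [Finsupp.weight_single, blockWeight, he]

theorem IsStandardExponent.weight_none_lt (hanti : AntitoneOn r (Set.Icc 1 ℓ))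
    (hd : IsStandardExponent d) {u : JordanIndex ℓ k r} (hu : d u ≠ 0) :
    Finsupp.weight blockWeight d none < r u.a := by
  obtain ⟨v, e, rfl, hle, he⟩ := hd.exists_eq_single_add (by rintro rfl; exact hu rfl)
  have hr : r v.a ≤ r u.a :=
    hanti ⟨u.one_le_a, u.a_le⟩ ⟨v.one_le_a, v.a_le⟩ (a_le_of_le (hle u hu))
  have h1 := v.one_le_c
  have h2 := v.c_le
  rw [weight_blockWeight_single_add_none he]
  omega

theorem le_of_weight_blockWeight_eq (hle : ∀ u, d u ≠ 0 → v ≤ u)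
    (hd : Finsupp.weight blockWeight d none = v.c - 1)
    (h : Finsupp.weight blockWeight m = Finsupp.weight blockWeight d) (hs : m s ≠ 0) : v ≤ s := by
  by_contra! hsv
  obtain ⟨u, hu, hus⟩ : ∃ u, d u ≠ 0 ∧ (u.a, u.b) = (s.a, s.b) := by
    rw [← weight_blockWeight_some_ne_zero_iff, ← h, weight_blockWeight_some_ne_zero_iff]
    exact ⟨s, hs, rfl⟩
  have hvs : v.c < s.c :=
    c_lt_of_lt_of_le hsv (hle u hu) (Prod.mk.inj hus).1 (Prod.mk.inj hus).2
  have hsv' : s.c - 1 ≤ v.c - 1 := by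
    simpa [h, hd, blockWeight] using Finsupp.le_weight_of_ne_zero' blockWeight hs none
  have h1 := v.one_le_c
  omega

theorem IsStandardExponent.eq_of_toSyn_le (hd : IsStandardExponent d)
    (h : Finsupp.weight blockWeight m = Finsupp.weight blockWeight d)
    (hmd : (grevlex _).toSyn m ≤ (grevlex _).toSyn d) : m = d := by
  by_contra hne
  have hdeg : m.degree = d.degree := by
    have hdeg := congrArg Finsupp.degree h
    rwa [degree_weight_blockWeight, degree_weight_blockWeight, h, add_left_inj] at hdeg
  obtain ⟨s, heq, hs⟩ := (((Grevlex.lt_iff m d).1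
    (hmd.lt_of_ne ((grevlex _).toSyn.injective.ne hne))).resolve_left hdeg.not_lt).2
  have h0 : d ≠ 0 := by
    rintro rfl
    exact hne ((Finsupp.degree_eq_zero_iff m).1 (hdeg.trans (map_zero _)))
  obtain ⟨v, e, rfl, hle, he⟩ := hd.exists_eq_single_add h0
  have hvs : v ≤ s := le_of_weight_blockWeight_eq hle (weight_blockWeight_single_add_none he) h
    (Nat.ne_zero_of_lt hs)
  have hmv : m v ≠ 0 := by
    obtain hvs | rfl := hvs.lt_or_eq
    · simp [heq v hvs]
    · exact Nat.ne_zero_of_lt hs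
  obtain ⟨e', rfl⟩ := exists_add_of_le (Finsupp.single_le_iff.2 (Nat.one_le_iff_ne_zero.2 hmv))
  rw [map_add, map_add, add_right_inj] at h
  exact hne (by rw [eq_of_weight_blockWeight_eq he h])

end StandardExponent

section BlockIdeal

variable {K : Type*} {ℓ : ℕ} {k r : ℕ → ℕ}

/-- The ideal generated by the monomials `y(i₁, i₂) t ^ r_{i₁}` in the ring that contains the
monomials `y(i₁, i₂) t ^ (i₃ - 1)` of `blockWeight`. Modulo it, `x(i) ↦ y(i₁, i₂) t ^ (i₃ - 1)`
describes `rowVar` also beyond the last row of a block. -/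
noncomputable def blockIdeal (K : Type*) [CommSemiring K] (ℓ : ℕ) (k r : ℕ → ℕ) :
    Ideal (MvPolynomial (Option (ℕ × ℕ)) K) :=
  Ideal.span ((fun s => monomial s (1 : K)) '' Set.range fun i : JordanIndex ℓ k r =>
    Finsupp.single (some (i.a, i.b)) 1 + Finsupp.single none (r i.a))

theorem coeff_eq_zero_of_mem_blockIdeal [CommSemiring K]
    {f : MvPolynomial (Option (ℕ × ℕ)) K}
    (hf : f ∈ blockIdeal K ℓ k r) {s : Option (ℕ × ℕ) →₀ ℕ}
    (hs : ∀ i : JordanIndex ℓ k r, s (some (i.a, i.b)) ≠ 0 → s none < r i.a) :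
    coeff s f = 0 := by
  by_contra hne
  obtain ⟨_, ⟨i, rfl⟩, hle⟩ := mem_ideal_span_monomial_image.1 hf s (mem_support_iff.2 hne)
  have hsome : 1 ≤ s (some (i.a, i.b)) := by simpa using hle (some (i.a, i.b))
  have hnone : r i.a ≤ s none := by simpa using hle none
  exact (hs i (Nat.one_le_iff_ne_zero.1 hsome)).not_ge hnone

theorem mk_monomialHom_rowVar [CommRing K] (i : JordanIndex ℓ k r) (n : ℕ) :
    Ideal.Quotient.mk (blockIdeal K ℓ k r) (monomialHom K blockWeight (rowVar K i (n + 1))) =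
      Ideal.Quotient.mk (blockIdeal K ℓ k r) (X (some (i.a, i.b)) * X none ^ n) := by
  rw [X_pow_eq_monomial, X, monomial_mul, one_mul]
  obtain h | h := lt_or_ge n (r i.a)
  · rw [rowVar_of_le i n.succ_pos h, X, monomialHom_monomial, Finsupp.weight_single, one_smul]
    rfl
  · rw [rowVar_of_lt i (Nat.lt_succ_of_le h), map_zero, map_zero, eq_comm,
      Ideal.Quotient.eq_zero_iff_mem]
    refine mem_ideal_span_monomial_image.2 fun s hs => ⟨_, ⟨i, rfl⟩, ?_⟩
    rw [Finset.mem_singleton.1 (support_monomial_subset hs)]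
    exact add_le_add le_rfl (Finsupp.single_mono h)

theorem monomialHom_mem_blockIdeal [Field K] {lam : K} {f : MvPolynomial (JordanIndex ℓ k r) K}
    (hf : f ∈ matrixIdeal (jordanMatrix ℓ k r lam)) :
    monomialHom K blockWeight f ∈ blockIdeal K ℓ k r := by
  rw [← Ideal.Quotient.eq_zero_iff_mem]
  refine Submodule.span_induction ?_ ?_ ?_ ?_ hf
  · rintro _ ⟨i, j, rfl⟩
    have hX : ∀ i : JordanIndex ℓ k r, Ideal.Quotient.mk (blockIdeal K ℓ k r)
        (monomialHom K blockWeight (X i)) =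
          Ideal.Quotient.mk _ (X (some (i.a, i.b)) * X none ^ (i.c - 1)) := fun i => by
      rw [← mk_monomialHom_rowVar, Nat.sub_add_cancel i.one_le_c, rowVar_self]
    rw [det_submatrix_augmentedMatrix_jordanMatrix]
    simp only [map_sub, map_mul, hX, mk_monomialHom_rowVar, map_pow]
    obtain ⟨p, hp⟩ := Nat.exists_eq_add_of_le' i.one_le_c
    obtain ⟨q, hq⟩ := Nat.exists_eq_add_of_le' j.one_le_c
    rw [hp, hq, Nat.add_sub_cancel, Nat.add_sub_cancel]
    ring
  · simp
  · intro f g _ _ hf hg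
    rw [map_add, map_add, hf, hg, add_zero]
  · intro c f _ hf
    rw [smul_eq_mul, map_mul, map_mul, hf, mul_zero]

theorem not_isStandardExponent_degree [Field K] {lam : K}
    (hanti : AntitoneOn r (Set.Icc 1 ℓ)) {f : MvPolynomial (JordanIndex ℓ k r) K}
    (hf : f ∈ matrixIdeal (jordanMatrix ℓ k r lam)) (h0 : f ≠ 0) :
    ¬ IsStandardExponent ((grevlex _).degree f) := by
  intro hstd
  have hcoeff : coeff ((grevlex _).degree f) f = 0 := by
    rw [← coeff_weight_monomialHom (w := blockWeight) fun e he hw =>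
      hstd.eq_of_toSyn_le hw ((grevlex _).le_degree he)]
    refine coeff_eq_zero_of_mem_blockIdeal (monomialHom_mem_blockIdeal hf) fun i hi => ?_
    obtain ⟨u, hu, hui⟩ := weight_blockWeight_some_ne_zero_iff.1 hi
    exact (Prod.mk.inj hui).1 ▸ hstd.weight_none_lt hanti hu
  exact h0 ((grevlex _).leadingCoeff_eq_zero_iff.1 hcoeff)

end BlockIdeal

section ReducedGroebnerBasis

variable {K : Type*} [Field K] {ℓ : ℕ} {k r : ℕ → ℕ}

theorem isGroebnerBasis_groebnerG₁_union_groebnerG₂ (lam : K)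
    (hanti : AntitoneOn r (Set.Icc 1 ℓ)) :
    IsGroebnerBasis (grevlex (JordanIndex ℓ k r)) (groebnerG₁ K ℓ k r ∪ groebnerG₂ K ℓ k r)
      (matrixIdeal (jordanMatrix ℓ k r lam)) := by
  refine .of_exists_degree_le ?_ (fun g hg => ?_) fun f hf h0 => ?_
  · refine (Set.finite_range fun p : JordanIndex ℓ k r × JordanIndex ℓ k r =>
      groebnerElement K p.1 p.2).subset fun g hg => ?_
    obtain ⟨i, j, -, -, rfl⟩ := mem_groebnerG₁_union_groebnerG₂.1 hg
    exact ⟨(i, j), rfl⟩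
  · obtain ⟨i, j, -, -, rfl⟩ := mem_groebnerG₁_union_groebnerG₂.1 hg
    exact groebnerElement_mem_matrixIdeal lam i j
  · have hnot := not_isStandardExponent_degree hanti hf h0
    simp only [IsStandardExponent, not_forall, not_not] at hnot
    obtain ⟨i, j, hi, hji, hle⟩ := hnot
    exact ⟨groebnerElement K i j, mem_groebnerG₁_union_groebnerG₂.2 ⟨i, j, hi, hji, rfl⟩,
      (monic_groebnerElement hi hji).ne_zero, (degree_groebnerElement hi hji).trans_le hle⟩

theorem monomial_notMem_span_leadingTerm {g : MvPolynomial (JordanIndex ℓ k r) K}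
    (hg : g ∈ groebnerG₁ K ℓ k r ∪ groebnerG₂ K ℓ k r) {d : JordanIndex ℓ k r →₀ ℕ}
    (hd : d ∈ g.support) :
    monomial d (1 : K) ∉ Ideal.span
      ((grevlex _).leadingTerm '' ((groebnerG₁ K ℓ k r ∪ groebnerG₂ K ℓ k r) \ {g})) := by
  rw [monomial_mem_span_leadingTerm_iff]
  rintro ⟨_, ⟨hg', hne⟩, -, hle⟩
  obtain ⟨i, j, hi, hji, rfl⟩ := mem_groebnerG₁_union_groebnerG₂.1 hg
  obtain ⟨i', j', hi', hji', rfl⟩ := mem_groebnerG₁_union_groebnerG₂.1 hg'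
  exact hne (groebnerElement_eq_of_degree_le hi hji hi' hji' hd hle)

theorem matrixIdeal_jordanMatrix_ne_bot (lam : K) {i : JordanIndex ℓ k r} (hi : i.c ≠ 1) :
    matrixIdeal (jordanMatrix ℓ k r lam) ≠ ⊥ := fun h =>
  (monic_groebnerElement (K := K) hi le_rfl).ne_zero
    ((Submodule.mem_bot _).1 (h ▸ groebnerElement_mem_matrixIdeal lam i i))

end ReducedGroebnerBasis

theorem mainTheorem6_general {K : Type*} [Field K] (lam : K) {ℓ : ℕ} (hℓ : 1 ≤ ℓ) (k r : ℕ → ℕ)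
    (hk : 1 ≤ k 1) (hr : 1 ≤ r 1) (hanti : AntitoneOn r (Set.Icc 1 ℓ)) :
    IsReducedGroebnerBasis (grevlex (JordanIndex ℓ k r)) (groebnerG K ℓ k r)
      (matrixIdeal (jordanMatrix ℓ k r lam)) := by
  rw [groebnerG]
  split_ifs with h1
  · have hle : ∀ i : JordanIndex ℓ k r, r i.a ≤ 1 := fun i =>
      (hanti ⟨le_rfl, hℓ⟩ ⟨i.one_le_a, i.a_le⟩ i.one_le_a).trans h1.le
    rw [matrixIdeal_jordanMatrix_eq_bot lam hle]
    exact isReducedGroebnerBasis_bot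
  · let i : JordanIndex ℓ k r := ⟨1, 1, 2, le_rfl, hℓ, le_rfl, hk, one_le_two, by omega⟩
    have hbot : matrixIdeal (jordanMatrix ℓ k r lam) ≠ ⊥ :=
      matrixIdeal_jordanMatrix_ne_bot lam (i := i) (Nat.succ_ne_self 1)
    refine ⟨isGroebnerBasis_groebnerG₁_union_groebnerG₂ lam hanti, fun h => absurd h hbot,
      fun _ => ⟨fun g hg => ?_, fun g hg d hd => monomial_notMem_span_leadingTerm hg hd⟩⟩
    obtain ⟨i, j, hi, hji, rfl⟩ := mem_groebnerG₁_union_groebnerG₂.1 hg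
    exact monic_groebnerElement hi hji

theorem mainTheorem6 {K : Type*} [Field K] (lam : K) (ℓ : ℕ) (hℓ : 1 ≤ ℓ) (k r : ℕ → ℕ)
    (hk : ∀ a ∈ Set.Icc 1 ℓ, 1 ≤ k a) (hr : ∀ a ∈ Set.Icc 1 ℓ, 1 ≤ r a)
    (hanti : StrictAntiOn r (Set.Icc 1 ℓ)) :
    IsReducedGroebnerBasis (grevlex (JordanIndex ℓ k r)) (groebnerG K ℓ k r)
      (matrixIdeal (jordanMatrix ℓ k r lam)) :=
  mainTheorem6_general lam hℓ k r (hk 1 ⟨le_rfl, hℓ⟩) (hr 1 ⟨le_rfl, hℓ⟩) hanti.antitoneOn
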